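/- Let $N$ be a connected (finite-dimensional, real, smooth) Lie group with identity $e$ and Lie algebra $\mathfrak n\simeq T_eN$, let $g=\langle\cdot,\cdot\rangle$ be a left-invariant Riemannian metric on $N$, and let $F$ be a left-invariant Lorentz force: a smooth, left-invariant endomorphism of $TN$, skew-symmetric for $g$, such that the $2$-form $\omega^F(X,Y)=g(FX,Y)$ is closed. Let $\pi:TN\to N$ be the projection, let $\eta$ be the tautological $1$-form on $TN$, $\eta_v(U)=g(v,\pi_*U)$, and set $\Omega^F=-d\eta+\pi^*\omega^F$. For differentiable $\phi:TN\to\mathbb R$ the Hamiltonian vector field $X_\phi$ is defined by $\Omega^F(X_\phi,U)=d\phi(U)$ for all $U$, and $\{\phi,\psi\}^F=\Omega^F(X_\phi,X_\psi)$. For $\xi_1,\xi_2\in\mathfrak n$ let $\bar\xi_i$ be the right-invariant vector field on $N$ (automatically a Killing field) with $\bar\xi_i(e)=\xi_i$, and let $f_1,f_2:N\to\mathbb R$ be functions with $df_i=g(F\bar\xi_i,\cdot)$, so that $\xi_i^F=\bar\xi_i+f_i$ are magnetic Killing vector fields. Let $\phi_{\xi_i^F}:TN\to\mathbb R$, $\phi_{\xi_i^F}(v)=g(\bar\xi_i(\pi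 v),v)+f_i(\pi v)$, be the associated functions. Then $\Omega^F$ is nondegenerate (so that Hamiltonian vector fields are well defined), and $$\{\phi_{\xi_1^F},\phi_{\xi_2^F}\}^F=0\ \text{ on } TN\quad\Longleftrightarrow\quad [\xi_1,\xi_2]=0\ \text{ and }\ \omega^F(\xi_1,\xi_2)=0 .$$ -/

import Mathlib

open Bundle Set
open scoped Manifold ContDiff

noncomputable section

namespace MagneticLie

/-! ### Differential forms on a manifold -/

section Forms

variable {E : Type*} [NormedAddCommGroup E] [NormedSpace ℝ E]
  {H : Type*} [TopologicalSpace H] (I : ModelWithCorners ℝ E H)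
  {M : Type*} [TopologicalSpace M] [ChartedSpace H M]

/-- Exterior derivative of a differential `k`-form on a manifold: at `x`, read the form in the
preferred chart at `x`, apply the exterior derivative of the model vector space (which carries no
normalizing factor, so `dη(X, Y) = X η(Y) - Y η(X) - η([X, Y])`), and transport the result back to
the tangent space at `x`. -/
def mextDeriv {k : ℕ} (α : ∀ x : M, (TangentSpace I x) [⋀^Fin k]→L[ℝ] ℝ) (x : M) :
    (TangentSpace I x) [⋀^Fin (k + 1)]→L[ℝ] ℝ :=
  (extDerivWithin
    (fun y : E => (α ((extChartAt I x).symm y)).compContinuousLinearMap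
      (mfderivWithin 𝓘(ℝ, E) I (extChartAt I x).symm (range I) y : E →L[ℝ] _))
    (range I) (extChartAt I x x)).compContinuousLinearMap
      (mfderiv I 𝓘(ℝ, E) (extChartAt I x) x : _ →L[ℝ] E)

/-- The `2`-form given by a continuous bilinear form that vanishes on the diagonal. -/
def twoForm (B : E →L[ℝ] E →L[ℝ] ℝ) (hB : ∀ v, B v v = 0) : E [⋀^Fin 2]→L[ℝ] ℝ where
  toFun v := B (v 0) (v 1)
  map_update_add' := by
    intro _ v i x y
    fin_cases i <;> simp [Function.update]
  map_update_smul' := by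
    intro _ v i c x
    fin_cases i <;> simp [Function.update]
  cont := by fun_prop
  map_eq_zero_of_eq' := by
    intro v i j hij hne
    fin_cases i <;> fin_cases j <;> simp_all

end Forms

/-! ### Hamiltonian vector fields and Poisson brackets of a `2`-form -/

section Poisson

variable {E : Type*} [NormedAddCommGroup E] [NormedSpace ℝ E]
  {H : Type*} [TopologicalSpace H] {I : ModelWithCorners ℝ E H}
  {M : Type*} [TopologicalSpace M] [ChartedSpace H M]

/-- Nondegeneracy of a `2`-form. -/
def IsNondegenerate (Ω : ∀ x : M, (TangentSpace I x) [⋀^Fin 2]→L[ℝ] ℝ) : Prop :=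
  ∀ (x : M) (X : TangentSpace I x), (∀ U : TangentSpace I x, Ω x ![X, U] = 0) → X = 0

/-- The Hamiltonian vector field `X_φ` of `φ`: its value at `x` is the vector with
`Ω(X_φ, U) = dφ(U)` for all `U` (unique when `Ω` is nondegenerate). -/
def hamiltonianVectorField (Ω : ∀ x : M, (TangentSpace I x) [⋀^Fin 2]→L[ℝ] ℝ) (φ : M → ℝ)
    (x : M) : TangentSpace I x :=
  Classical.epsilon fun X : TangentSpace I x =>
    ∀ U : TangentSpace I x, Ω x ![X, U] = (mfderiv I 𝓘(ℝ, ℝ) φ x U : ℝ)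

/-- The Poisson bracket `{φ, ψ} = Ω(X_φ, X_ψ)`. -/
def poissonBracket (Ω : ∀ x : M, (TangentSpace I x) [⋀^Fin 2]→L[ℝ] ℝ) (φ ψ : M → ℝ)
    (x : M) : ℝ :=
  Ω x ![hamiltonianVectorField Ω φ x, hamiltonianVectorField Ω ψ x]

end Poisson

/-! ### Lorentz forces and the twisted symplectic form -/

section Magnetic

variable {E : Type*} [NormedAddCommGroup E] [NormedSpace ℝ E]
  {N : Type*} [TopologicalSpace N] [ChartedSpace E N] [IsManifold 𝓘(ℝ, E) ∞ N]

/-- Smooth Riemannian metrics on `N`. -/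
abbrev Metric (E : Type*) [NormedAddCommGroup E] [NormedSpace ℝ E]
    (N : Type*) [TopologicalSpace N] [ChartedSpace E N] [IsManifold 𝓘(ℝ, E) ∞ N] :=
  ContMDiffRiemannianMetric 𝓘(ℝ, E) ∞ E (fun p : N => TangentSpace 𝓘(ℝ, E) p)

/-- A Lorentz force on `(N, g)`: a smooth endomorphism `F` of `TN`, skew-symmetric for `g`, whose
associated `2`-form `ω^F(X, Y) = g(F X, Y)` is closed. -/
structure LorentzForce (g : Metric E N) where
  toFun : ∀ p : N, TangentSpace 𝓘(ℝ, E) p →L[ℝ] TangentSpace 𝓘(ℝ, E) p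
  smooth : ContMDiff 𝓘(ℝ, E) (𝓘(ℝ, E).prod 𝓘(ℝ, E →L[ℝ] E)) ∞
    (fun p => TotalSpace.mk' (E →L[ℝ] E) p (toFun p))
  skew : ∀ (p : N) (X : TangentSpace 𝓘(ℝ, E) p), g.inner p (toFun p X) X = 0
  closed : mextDeriv 𝓘(ℝ, E)
    (fun p : N => (twoForm (E := E) ((g.inner p).comp (toFun p)) (skew p) :
      (TangentSpace 𝓘(ℝ, E) p) [⋀^Fin 2]→L[ℝ] ℝ)) = 0

/-- The magnetic field `ω^F(X, Y) = g(F X, Y)`. -/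
def LorentzForce.form {g : Metric E N} (F : LorentzForce g) (p : N) :
    (TangentSpace 𝓘(ℝ, E) p) [⋀^Fin 2]→L[ℝ] ℝ :=
  twoForm (E := E) ((g.inner p).comp (F.toFun p)) (F.skew p)

/-- The differential of the projection `π : TN → N` at `v`. -/
def dproj (v : TangentBundle 𝓘(ℝ, E) N) :
    TangentSpace 𝓘(ℝ, E).tangent v →L[ℝ] TangentSpace 𝓘(ℝ, E) v.proj :=
  mfderiv 𝓘(ℝ, E).tangent 𝓘(ℝ, E) (fun w : TangentBundle 𝓘(ℝ, E) N => w.proj) v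

/-- The tautological `1`-form on `TN`: `η_v(U) = g(v, π_* U)`. -/
def tautological (g : Metric E N) (v : TangentBundle 𝓘(ℝ, E) N) :
    (TangentSpace 𝓘(ℝ, E).tangent v) [⋀^Fin 1]→L[ℝ] ℝ :=
  ContinuousAlternatingMap.ofSubsingleton ℝ _ ℝ (0 : Fin 1)
    ((g.inner v.proj v.snd).comp (dproj v))

/-- The twisted symplectic form `Ω^F = -dη + π^* ω^F` on `TN`. -/
def twistedForm {g : Metric E N} (F : LorentzForce g) (v : TangentBundle 𝓘(ℝ, E) N) :
    (TangentSpace 𝓘(ℝ, E).tangent v) [⋀^Fin 2]→L[ℝ] ℝ :=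
  -mextDeriv 𝓘(ℝ, E).tangent (tautological g) v
    + (F.form v.proj).compContinuousLinearMap (dproj v)

/-- The function `φ_{ξ + f}(v) = g(ξ, v) + f(π v)` on `TN` associated with the sum of a vector
field `ξ` and a function `f`. -/
def momentum (g : Metric E N) (ξ : ∀ p : N, TangentSpace 𝓘(ℝ, E) p) (f : N → ℝ)
    (v : TangentBundle 𝓘(ℝ, E) N) : ℝ :=
  g.inner v.proj (ξ v.proj) v.snd + f v.proj

/-- The equation `df = F(ξ)^♭`, i.e. `df(X) = g(F ξ, X)`, under which a Killing vector field `ξ` and a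
function `f` form a magnetic Killing vector field `ξ + f`. It includes that `f` is
differentiable. -/
def IsMagneticPotential {g : Metric E N} (F : LorentzForce g)
    (ξ : ∀ p : N, TangentSpace 𝓘(ℝ, E) p) (f : N → ℝ) : Prop :=
  ∀ p : N, HasMFDerivAt 𝓘(ℝ, E) 𝓘(ℝ, ℝ) f p (g.inner p (F.toFun p (ξ p)))

end Magnetic

/-! ### Invariance on Lie groups -/

section LieGroup

variable {E : Type*} [NormedAddCommGroup E] [NormedSpace ℝ E]
  {N : Type*} [TopologicalSpace N] [ChartedSpace E N] [Group N] [LieGroup 𝓘(ℝ, E) ∞ N]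

/-- The differential of the left translation `L_h` at `p`. -/
def dleft (h p : N) : TangentSpace 𝓘(ℝ, E) p →L[ℝ] TangentSpace 𝓘(ℝ, E) (h * p) :=
  mfderiv 𝓘(ℝ, E) 𝓘(ℝ, E) (fun q : N => h * q) p

/-- The metric is invariant under all left translations. -/
def IsLeftInvariantMetric (g : Metric E N) : Prop :=
  ∀ (h p : N) (X Y : TangentSpace 𝓘(ℝ, E) p),
    g.inner (h * p) (dleft h p X) (dleft h p Y) = g.inner p X Y

/-- The Lorentz force is invariant under all left translations. -/
def LorentzForce.IsLeftInvariant {g : Metric E N} (F : LorentzForce g) : Prop :=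
  ∀ (h p : N) (X : TangentSpace 𝓘(ℝ, E) p),
    F.toFun (h * p) (dleft h p X) = dleft h p (F.toFun p X)

/-- The right-invariant vector field `ξ̄` with value `ξ` at the identity: `ξ̄(p) = (R_p)_* ξ`. -/
def rightInvariantField (ξ : GroupLieAlgebra 𝓘(ℝ, E) N) (p : N) : TangentSpace 𝓘(ℝ, E) p :=
  mfderiv 𝓘(ℝ, E) 𝓘(ℝ, E) (fun q : N => q * p) (1 : N) ξ

end LieGroup

end MagneticLie

end

/-!
The theorem rests on the identity, for `v` in the fibre over `p`,

`{φ_{ξ₁ + f₁}, φ_{ξ₂ + f₂}}(v) = ω^F(ξ̄₁, ξ̄₂)(p) - g([ξ̄₁, ξ̄₂](p), v)`,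

proved in `poissonBracket_momentum`. In the chart of `TN` induced by a chart of `N`, with `G` the
Gram matrix of the metric, the tautological form is `G(b, da)`, so `Ω^F` is a block matrix with
invertible off-diagonal blocks `±G`; this gives nondegeneracy. Solving for the Hamiltonian vector
field of `φ_{ξ + f}`, its horizontal part is `ξ`, and the derivative of `G` cancels in the bracket.
The identity therefore holds for all differentiable vector fields with a magnetic potential, and
neither the Killing equation nor the invariance of `g` and `F` enters.

The right-hand side is affine in `v` on each fibre, so the bracket vanishes on `TN` if and only if
`[ξ̄₁, ξ̄₂] = 0` and `ω^F(ξ̄₁, ξ̄₂) = 0` on `N`. Both conditions can be read off at the identity.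
For the first, `[ξ̄₁, ξ̄₂]` is the right-invariant field of `-[ξ₁, ξ₂]`, because inversion carries
left-invariant fields to right-invariant ones (`mlieBracket_rightInvariantField`). For the second,
once the fields commute the function `ω^F(ξ̄₁, ξ̄₂)` is stationary (`hasMFDerivAt_form_zero`): its
differential is `±ω^F([ξ̄₁, ξ̄₂], ·)`, since `ω^F` and its contractions `df₁`, `df₂` with the two
fields are closed. On a connected group it is then constant.
-/

open Bundle Set
open scoped Manifold ContDiff

noncomputable section

namespace MagneticLie

/-! ### Alternating forms and exterior derivatives on a normed space -/

section Alternating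
set_option maxSynthPendingDepth 3
variable {V : Type*} [NormedAddCommGroup V] [NormedSpace ℝ V]

theorem alternating_two_cons_add (Ω : V [⋀^Fin 2]→L[ℝ] ℝ) (x y u : V) :
    Ω ![x + y, u] = Ω ![x, u] + Ω ![y, u] := by
  have h (z : V) : Function.update ![0, u] 0 z = ![z, u] := by ext i; fin_cases i <;> simp
  simpa only [h] using Ω.map_update_add ![0, u] 0 x y

theorem alternating_two_cons_smul (Ω : V [⋀^Fin 2]→L[ℝ] ℝ) (c : ℝ) (x u : V) :
    Ω ![c • x, u] = c * Ω ![x, u] := by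
  have h (z : V) : Function.update ![0, u] 0 z = ![z, u] := by ext i; fin_cases i <;> simp
  simpa only [h, smul_eq_mul] using Ω.map_update_smul ![0, u] 0 c x

theorem alternating_two_swap (Ω : V [⋀^Fin 2]→L[ℝ] ℝ) (x u : V) :
    Ω ![x, u] = -Ω ![u, x] := by
  have h : ![u, x] ∘ Equiv.swap 0 1 = ![x, u] := by ext i; fin_cases i <;> simp
  simpa only [h] using! Ω.map_swap ![u, x] (i := 0) (j := 1) (by simp)

/-- In finite dimension a nondegenerate `2`-form represents every linear functional. -/
theorem exists_alternating_two_eq [FiniteDimensional ℝ V] (Ω : V [⋀^Fin 2]→L[ℝ] ℝ)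
    (hω : ∀ x, (∀ u, Ω ![x, u] = 0) → x = 0) (l : V →L[ℝ] ℝ) :
    ∃ x, ∀ u, Ω ![x, u] = l u := by
  let B : V →ₗ[ℝ] Module.Dual ℝ V := LinearMap.mk₂ ℝ (fun x u => Ω ![x, u])
    (alternating_two_cons_add Ω) (alternating_two_cons_smul Ω)
    (fun x y z => by
      rw [alternating_two_swap Ω x, alternating_two_swap Ω x y, alternating_two_swap Ω x z,
        alternating_two_cons_add]; ring)
    (fun c x y => by
      rw [alternating_two_swap Ω x, alternating_two_swap Ω x y, alternating_two_cons_smul]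
      simp)
  have hinj : Function.Injective B := by
    rw [injective_iff_map_eq_zero]
    exact fun x hx => hω x fun u => by simpa [B] using LinearMap.congr_fun hx u
  have hsurj := (LinearMap.injective_iff_surjective_of_finrank_eq_finrank
    (Subspace.dual_finrank_eq (K := ℝ) (V := V)).symm).1 hinj
  obtain ⟨x, hx⟩ := hsurj (l : V →ₗ[ℝ] ℝ)
  exact ⟨x, fun u => by simpa [B] using LinearMap.congr_fun hx u⟩

theorem extDeriv_ofSubsingleton_apply {θ : V → V →L[ℝ] ℝ} {x : V} (hθ : DifferentiableAt ℝ θ x)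
    (u w : V) :
    extDeriv (fun y => ContinuousAlternatingMap.ofSubsingleton ℝ V ℝ (0 : Fin 1) (θ y)) x ![u, w] =
      fderiv ℝ θ x u w - fderiv ℝ θ x w u := by
  have hd : DifferentiableAt ℝ
      (fun y => ContinuousAlternatingMap.ofSubsingleton ℝ V ℝ (0 : Fin 1) (θ y)) x :=
    (ContinuousAlternatingMap.ofSubsingletonLIE (𝕜 := ℝ) (E := V) (F := ℝ)
      (0 : Fin 1)).differentiableAt.comp x hθ
  rw [extDeriv_apply hd]
  have h (z : V) : fderiv ℝ (fun y => θ y z) x = (fderiv ℝ θ x).flip z := by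
    rw [fderiv_clm_apply hθ (by fun_prop)]; simp
  simp [Fin.sum_univ_two, Fin.removeNth, h]
  ring

/-- The differential of a variable `2`-form `β(u, w)` is the cyclic sum of its derivatives. -/
theorem extDeriv_twoForm_apply {β : V → V →L[ℝ] V →L[ℝ] ℝ} {x : V}
    (hβ : DifferentiableAt ℝ β x) (hskew : ∀ y v, β y v v = 0) (u v w : V) :
    extDeriv (fun y => twoForm (β y) (hskew y)) x ![u, v, w] =
      fderiv ℝ β x u v w - fderiv ℝ β x v u w + fderiv ℝ β x w u v := by
  -- `twoForm` takes a proof of skewness, so its smooth dependence on `β` is not visible. On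
  -- skew forms it agrees with half the alternatization, which is a continuous linear map `T`.
  let T : (V →L[ℝ] V →L[ℝ] ℝ) →L[ℝ] V [⋀^Fin 2]→L[ℝ] ℝ :=
    (1 / 2 : ℝ) • (ContinuousAlternatingMap.alternatizeUncurryFinCLM ℝ V ℝ).comp
      (ContinuousLinearMap.compL ℝ V (V →L[ℝ] ℝ) (V [⋀^Fin 1]→L[ℝ] ℝ)
        (ContinuousAlternatingMap.ofSubsingletonLIE (𝕜 := ℝ) (E := V) (F := ℝ)
          (0 : Fin 1)).toContinuousLinearEquiv)
  have hT : (fun y => twoForm (β y) (hskew y)) = fun y => T (β y) := by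
    ext y z
    have h2 : β y (z 0) (z 1) + β y (z 1) (z 0) = 0 := by
      have := hskew y (z 0 + z 1)
      simpa [hskew, add_comm] using this
    have hz : twoForm (β y) (hskew y) z = β y (z 0) (z 1) := rfl
    simp [T, hz, ContinuousAlternatingMap.alternatizeUncurryFin_apply, Fin.sum_univ_two,
      Fin.removeNth]
    linarith
  have hd : DifferentiableAt ℝ (fun y => twoForm (β y) (hskew y)) x := by
    rw [hT]; exact T.differentiableAt.comp x hβ
  rw [extDeriv_apply hd]
  have h (y z : V) : fderiv ℝ (fun a => β a y z) x = ((fderiv ℝ β x).flip y).flip z := by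
    rw [fderiv_clm_apply (hβ.clm_apply (by fun_prop)) (by fun_prop),
      fderiv_clm_apply hβ (by fun_prop)]
    ext; simp
  have h' (v : Fin 2 → V) (y : V) : twoForm (β y) (hskew y) v = β y (v 0) (v 1) := rfl
  simp [Fin.sum_univ_three, Fin.removeNth, h', h, Fin.succAbove]
  ring

end Alternating

/-! ### Coordinate computations -/

section Coordinates
set_option maxSynthPendingDepth 3
open VectorField Filter Topology
variable {E : Type*} [NormedAddCommGroup E] [NormedSpace ℝ E]

/-- In coordinates, `η = G(b, da)` and `dη = (∂G)(b, da) + G(db, da)`, antisymmetrized. -/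
theorem extDeriv_tautological_apply {G : E → E →L[ℝ] E →L[ℝ] ℝ} {y : E × E}
    (hG : DifferentiableAt ℝ G y.1) (U V : E × E) :
    extDeriv (fun z : E × E => ContinuousAlternatingMap.ofSubsingleton ℝ (E × E) ℝ (0 : Fin 1)
        ((G z.1 z.2).comp (ContinuousLinearMap.fst ℝ E E))) y ![U, V] =
      fderiv ℝ G y.1 U.1 y.2 V.1 + G y.1 U.2 V.1
        - (fderiv ℝ G y.1 V.1 y.2 U.1 + G y.1 V.2 U.1) := by
  have h1 : HasFDerivAt (fun z : E × E => G z.1) ((fderiv ℝ G y.1).comp (.fst ℝ E E)) y :=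
    hG.hasFDerivAt.comp y (hasFDerivAt_fst (𝕜 := ℝ) (p := y))
  have h2 := (h1.clm_apply (hasFDerivAt_snd (𝕜 := ℝ) (p := y))).clm_comp
    (hasFDerivAt_const (ContinuousLinearMap.fst ℝ E E) y)
  rw [extDeriv_ofSubsingleton_apply h2.differentiableAt, h2.fderiv]
  simp
  ring

/-- In coordinates `φ = G(X, b) + h`; the product rule for its differential. -/
theorem fderiv_momentum_coord {G : E → E →L[ℝ] E →L[ℝ] ℝ} {X : E → E} {h : E → ℝ} {y : E × E}
    {α : E →L[ℝ] ℝ} (hG : DifferentiableAt ℝ G y.1) (hX : DifferentiableAt ℝ X y.1)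
    (hh : HasFDerivAt h α y.1) :
    ∃ l : E × E →L[ℝ] ℝ,
      HasFDerivAt (fun z : E × E => G z.1 (X z.1) z.2 + h z.1) l y ∧
      ∀ U, l U = fderiv ℝ G y.1 U.1 (X y.1) y.2 + G y.1 (fderiv ℝ X y.1 U.1) y.2
        + G y.1 (X y.1) U.2 + α U.1 := by
  have h1 : HasFDerivAt (fun z : E × E => G z.1) ((fderiv ℝ G y.1).comp (.fst ℝ E E)) y :=
    hG.hasFDerivAt.comp y (hasFDerivAt_fst (𝕜 := ℝ) (p := y))
  have h2 : HasFDerivAt (fun z : E × E => X z.1) ((fderiv ℝ X y.1).comp (.fst ℝ E E)) y :=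
    hX.hasFDerivAt.comp y (hasFDerivAt_fst (𝕜 := ℝ) (p := y))
  have h3 : HasFDerivAt (fun z : E × E => h z.1) (α.comp (.fst ℝ E E)) y :=
    hh.comp y (hasFDerivAt_fst (𝕜 := ℝ) (p := y))
  refine ⟨_, ((h1.clm_apply h2).clm_apply (hasFDerivAt_snd (𝕜 := ℝ) (p := y))).add h3, fun U => ?_⟩
  simp
  ring

/-- The Poisson bracket of two momentum functions in coordinates. In the formulas for `Ω` and `dφᵢ`
below, `D` is the derivative of the metric `G`, `b` the fibre coordinate, `w` the magnetic form and
`Aᵢ` the derivative of the `i`-th field. The derivative of the metric cancels, so the fields need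
not be Killing. -/
theorem bracket_momentum_coord {G w : E →L[ℝ] E →L[ℝ] ℝ} {D : E →L[ℝ] E →L[ℝ] E →L[ℝ] ℝ}
    {b x₁ x₂ : E} {A₁ A₂ : E →L[ℝ] E} {Ω : E × E → E × E → ℝ} {l₁ l₂ : E × E → ℝ}
    {X₁ X₂ : E × E}
    (hsymm : ∀ u v, G u v = G v u) (hD : ∀ z u v, D z u v = D z v u)
    (hpos : ∀ u, G u u = 0 → u = 0)
    (hΩ : ∀ U V, Ω U V = -(D U.1 b V.1 + G U.2 V.1 - (D V.1 b U.1 + G V.2 U.1)) + w U.1 V.1)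
    (hl₁ : ∀ U, l₁ U = D U.1 x₁ b + G (A₁ U.1) b + G x₁ U.2 + w x₁ U.1)
    (hl₂ : ∀ U, l₂ U = D U.1 x₂ b + G (A₂ U.1) b + G x₂ U.2 + w x₂ U.1)
    (hX₁ : ∀ U, Ω X₁ U = l₁ U) (hX₂ : ∀ U, Ω X₂ U = l₂ U) :
    Ω X₁ X₂ = w x₁ x₂ - G (A₂ x₁ - A₁ x₂) b := by
  -- Testing against vertical vectors shows that the horizontal part of `X₂` is the field itself.
  have h2 : X₂.1 = x₂ := by
    rw [← sub_eq_zero]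
    apply hpos
    have := hX₂ (0, X₂.1 - x₂)
    rw [hΩ, hl₂] at this
    simp at this
    have h := hsymm x₂ X₂.1
    simp
    linarith
  -- The vertical part of `X₂` enters `Ω X₁ X₂ = l₁ X₂` only through `G x₁ X₂.2`, which the
  -- horizontal test vector `(x₁, 0)` determines.
  have h3 := hX₂ (x₁, 0)
  rw [hX₁, hl₁]
  rw [hΩ, hl₂] at h3
  simp [h2] at h3 ⊢
  rw [hsymm X₂.2, hD x₂ b] at h3
  rw [hD x₁ b] at h3
  linarith

/-- Vertical test vectors `(0, V)` detect `X.1`, and horizontal ones then detect `X.2`. -/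
theorem nondegenerate_coord {G w : E →L[ℝ] E →L[ℝ] ℝ} {D : E →L[ℝ] E →L[ℝ] E →L[ℝ] ℝ}
    {b : E} {X : E × E}
    (hpos : ∀ u, G u u = 0 → u = 0)
    (hX : ∀ V : E × E, -(D X.1 b V.1 + G X.2 V.1 - (D V.1 b X.1 + G V.2 X.1)) + w X.1 V.1 = 0) :
    X = 0 := by
  have h1 : X.1 = 0 := hpos _ (by simpa using hX (0, X.1))
  have h2 : X.2 = 0 := hpos _ (by simpa [h1] using hX (X.2, 0))
  exact Prod.ext h1 h2

/-- If `β` is a closed `2`-form whose contractions with `X₁` and `X₂` are exact, and the two fields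
commute at `a`, then `β(X₁, X₂)` is stationary at `a`. -/
theorem hasFDerivAt_zero_of_closed {β : E → E →L[ℝ] E →L[ℝ] ℝ} {X₁ X₂ : E → E} {h₁ h₂ : E → ℝ}
    {a : E} (hβ : DifferentiableAt ℝ β a) (hX₁ : DifferentiableAt ℝ X₁ a)
    (hX₂ : DifferentiableAt ℝ X₂ a) (hskew : ∀ y v, β y v v = 0)
    (hclosed : ∀ u v w, fderiv ℝ β a u v w - fderiv ℝ β a v u w + fderiv ℝ β a w u v = 0)
    (hh₁ : ∀ᶠ y in 𝓝 a, HasFDerivAt h₁ (β y (X₁ y)) y)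
    (hh₂ : ∀ᶠ y in 𝓝 a, HasFDerivAt h₂ (β y (X₂ y)) y)
    (hcomm : lieBracket ℝ X₁ X₂ a = 0) :
    HasFDerivAt (fun y => β y (X₁ y) (X₂ y)) (0 : E →L[ℝ] ℝ) a := by
  have d₁ := hβ.hasFDerivAt.clm_apply hX₁.hasFDerivAt
  have d₂ := hβ.hasFDerivAt.clm_apply hX₂.hasFDerivAt
  -- The derivative of `β(Xᵢ, ·) = dhᵢ` is the Hessian of `hᵢ`, hence symmetric.
  have s₁ := second_derivative_symmetric_of_eventually hh₁ d₁
  have s₂ := second_derivative_symmetric_of_eventually hh₂ d₂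
  have d := d₁.clm_apply hX₂.hasFDerivAt
  have hsk (u v : E) : β a u v = -β a v u := by
    have := hskew a (u + v)
    simp [hskew] at this
    linarith
  have hDsk (z u v : E) : fderiv ℝ β a z u v = -fderiv ℝ β a z v u := by
    have e (x : E) : fderiv ℝ β a z x x = 0 := by
      have h1 : HasFDerivAt (fun y => β y x x) (((fderiv ℝ β a).flip x).flip x) a := by
        convert! (hβ.hasFDerivAt.clm_apply (hasFDerivAt_const x a)).clm_apply
          (hasFDerivAt_const x a) using 1
        ext; simp
      have h2 : HasFDerivAt (fun y => β y x x) (0 : E →L[ℝ] ℝ) a := by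
        simp only [hskew]; exact hasFDerivAt_const _ _
      simpa using DFunLike.congr_fun (h1.unique h2) z
    have := e (u + v)
    simp [e] at this
    linarith
  convert! d using 1
  ext u
  have t₁ := s₁ u (X₂ a)
  have t₂ := s₂ u (X₁ a)
  have c := hclosed u (X₁ a) (X₂ a)
  rw [lieBracket_eq, sub_eq_zero] at hcomm
  simp at t₁ t₂ ⊢
  rw [hcomm] at t₂
  have k₁ := hsk (X₁ a) (fderiv ℝ X₂ a u)
  have k₂ := hDsk u (X₂ a) (X₁ a)
  have k₃ := hDsk (X₁ a) u (X₂ a)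
  have k₄ := hDsk (X₂ a) u (X₁ a)
  linarith

end Coordinates

/-! ### Metric, magnetic form and vector fields in a chart -/

section Charts
set_option maxSynthPendingDepth 3
open VectorField Filter Topology
variable {E : Type*} [NormedAddCommGroup E] [NormedSpace ℝ E]
  {N : Type*} [TopologicalSpace N] [ChartedSpace E N] [IsManifold 𝓘(ℝ, E) ∞ N]

/-- The coordinate frame of the preferred chart at `p₀`: the differential of the inverse chart at
the coordinate point `a`, read as an endomorphism of the model space `E`. -/
def chartFrame (p₀ : N) (a : E) : E →L[ℝ] E :=
  mfderivWithin 𝓘(ℝ, E) 𝓘(ℝ, E) (extChartAt 𝓘(ℝ, E) p₀).symm (range 𝓘(ℝ, E)) a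

/-- The inner product at `p`, as a bilinear form on the model space `E`, which is definitionally
the fibre `T_p N`. -/
def metricAt (g : Metric E N) (p : N) : E →L[ℝ] E →L[ℝ] ℝ := g.inner p

/-- The Lorentz force at `p`, as an endomorphism of the model space `E`. -/
def forceAt {g : Metric E N} (F : LorentzForce g) (p : N) : E →L[ℝ] E := F.toFun p

/-- The Gram form of the metric in the coordinate frame of the preferred chart at `p₀`. -/
def metricCoord (g : Metric E N) (p₀ : N) (a : E) : E →L[ℝ] E →L[ℝ] ℝ :=
  (metricAt g ((extChartAt 𝓘(ℝ, E) p₀).symm a)).bilinearComp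
    (chartFrame p₀ a) (chartFrame p₀ a)

/-- The magnetic form `g(F·, ·)` in the coordinate frame of the preferred chart at `p₀`. -/
def formCoord {g : Metric E N} (F : LorentzForce g) (p₀ : N) (a : E) : E →L[ℝ] E →L[ℝ] ℝ :=
  ((metricAt g ((extChartAt 𝓘(ℝ, E) p₀).symm a)).comp
    (forceAt F ((extChartAt 𝓘(ℝ, E) p₀).symm a))).bilinearComp (chartFrame p₀ a) (chartFrame p₀ a)

/-- The components of a vector field in the coordinate frame of the preferred chart at `p₀`. -/
def fieldCoord (p₀ : N) (ξ : ∀ p : N, TangentSpace 𝓘(ℝ, E) p) (a : E) : E :=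
  (chartFrame p₀ a).inverse (ξ ((extChartAt 𝓘(ℝ, E) p₀).symm a))

theorem chartFrame_isInvertible {p₀ : N} {a : E} (ha : a ∈ (extChartAt 𝓘(ℝ, E) p₀).target) :
    (chartFrame p₀ a).IsInvertible := by
  exact isInvertible_mfderivWithin_extChartAt_symm ha

theorem chartFrame_self (p₀ : N) :
    chartFrame p₀ (extChartAt 𝓘(ℝ, E) p₀ p₀) = ContinuousLinearMap.id ℝ E := by
  exact mfderivWithin_range_extChartAt_symm

theorem chartFrame_fieldCoord {p₀ : N} {a : E} (ha : a ∈ (extChartAt 𝓘(ℝ, E) p₀).target)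
    (ξ : ∀ p : N, TangentSpace 𝓘(ℝ, E) p) :
    chartFrame p₀ a (fieldCoord p₀ ξ a) = ξ ((extChartAt 𝓘(ℝ, E) p₀).symm a) := by
  obtain ⟨e, he⟩ := chartFrame_isInvertible ha
  simp only [fieldCoord, ← he]
  rw [ContinuousLinearMap.inverse_equiv]
  exact e.apply_symm_apply _

theorem fieldCoord_self (p₀ : N) (ξ : ∀ p : N, TangentSpace 𝓘(ℝ, E) p) :
    fieldCoord p₀ ξ (extChartAt 𝓘(ℝ, E) p₀ p₀) = ξ p₀ := by
  rw [fieldCoord, chartFrame_self, extChartAt_to_inv, ContinuousLinearMap.inverse_id]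
  rfl

theorem metricCoord_self (g : Metric E N) (p₀ : N) :
    metricCoord g p₀ (extChartAt 𝓘(ℝ, E) p₀ p₀) = metricAt g p₀ := by
  unfold metricCoord
  rw [chartFrame_self, extChartAt_to_inv]
  rfl

theorem formCoord_self {g : Metric E N} (F : LorentzForce g) (p₀ : N) :
    formCoord F p₀ (extChartAt 𝓘(ℝ, E) p₀ p₀) =
      (metricAt g p₀).comp (forceAt F p₀) := by
  unfold formCoord
  rw [chartFrame_self, extChartAt_to_inv]
  rfl

theorem metricAt_symm (g : Metric E N) (p : N) (u v : E) :
    metricAt g p u v = metricAt g p v u :=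
  g.symm p u v

theorem eq_zero_of_metricAt_self (g : Metric E N) (p : N) (u : E) (hu : metricAt g p u u = 0) :
    u = 0 := by
  by_contra h
  exact (g.pos p u h).ne' hu

theorem metricAt_forceAt_self {g : Metric E N} (F : LorentzForce g) (p : N) (u : E) :
    metricAt g p (forceAt F p u) u = 0 :=
  F.skew p u

theorem metricCoord_apply (g : Metric E N) (p₀ : N) (a u v : E) :
    metricCoord g p₀ a u v = metricAt g ((extChartAt 𝓘(ℝ, E) p₀).symm a)
      (chartFrame p₀ a u) (chartFrame p₀ a v) :=
  rfl

theorem formCoord_apply {g : Metric E N} (F : LorentzForce g) (p₀ : N) (a u v : E) :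
    formCoord F p₀ a u v = metricAt g ((extChartAt 𝓘(ℝ, E) p₀).symm a)
      (forceAt F ((extChartAt 𝓘(ℝ, E) p₀).symm a) (chartFrame p₀ a u)) (chartFrame p₀ a v) :=
  rfl

theorem formCoord_skew {g : Metric E N} (F : LorentzForce g) (p₀ : N) (a u : E) :
    formCoord F p₀ a u u = 0 := by
  rw [formCoord_apply, metricAt_forceAt_self]

theorem metricCoord_symm (g : Metric E N) (p₀ : N) (a u v : E) :
    metricCoord g p₀ a u v = metricCoord g p₀ a v u := by
  rw [metricCoord_apply, metricCoord_apply, metricAt_symm]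

theorem hasMFDerivAt_extChartAt_symm {p₀ : N} {a : E} (ha : a ∈ (extChartAt 𝓘(ℝ, E) p₀).target) :
    HasMFDerivAt 𝓘(ℝ, E) 𝓘(ℝ, E) (extChartAt 𝓘(ℝ, E) p₀).symm a
      (chartFrame (E := E) p₀ a) := by
  have h : HasMFDerivWithinAt 𝓘(ℝ, E) 𝓘(ℝ, E) (extChartAt 𝓘(ℝ, E) p₀).symm (range 𝓘(ℝ, E)) a
      (chartFrame (E := E) p₀ a) := (mdifferentiableWithinAt_extChartAt_symm ha).hasMFDerivWithinAt
  rw [modelWithCornersSelf_coe, range_id] at h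
  exact hasMFDerivWithinAt_univ.1 h

theorem extChartAt_target_mem_nhds_self (p₀ : N) :
    (extChartAt 𝓘(ℝ, E) p₀).target ∈ 𝓝 (extChartAt 𝓘(ℝ, E) p₀ p₀) :=
  (isOpen_extChartAt_target p₀).mem_nhds (mem_extChartAt_target p₀)

/-- The coordinate frame is the inverse of the trivialization of `TN` at `p₀`, in which smoothness
of the metric and of the Lorentz force is expressed. -/
theorem chartFrame_eq_symmL {p₀ : N} {a : E} (ha : a ∈ (extChartAt 𝓘(ℝ, E) p₀).target) :
    ((trivializationAt E (TangentSpace 𝓘(ℝ, E)) p₀).symmL ℝ ((extChartAt 𝓘(ℝ, E) p₀).symm a) :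
      E →L[ℝ] E) = chartFrame p₀ a := by
  have h := (extChartAt 𝓘(ℝ, E) p₀).map_target ha
  rw [extChartAt_source] at h
  refine (TangentBundle.symmL_trivializationAt (I := 𝓘(ℝ, E)) h).trans ?_
  rw [(extChartAt 𝓘(ℝ, E) p₀).right_inv ha]
  rfl

/-- A function smooth at `p₀` is differentiable in the preferred chart at `p₀`. -/
theorem differentiableAt_comp_extChartAt_symm {G : Type*} [NormedAddCommGroup G] [NormedSpace ℝ G]
    {p₀ : N} {f : N → G} (hf : ContMDiffAt 𝓘(ℝ, E) 𝓘(ℝ, G) ∞ f p₀) :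
    DifferentiableAt ℝ (f ∘ (extChartAt 𝓘(ℝ, E) p₀).symm) (extChartAt 𝓘(ℝ, E) p₀ p₀) := by
  have h1 : ContMDiffAt 𝓘(ℝ, E) 𝓘(ℝ, E) ∞ (extChartAt 𝓘(ℝ, E) p₀).symm
      (extChartAt 𝓘(ℝ, E) p₀ p₀) :=
    (contMDiffOn_extChartAt_symm p₀).contMDiffAt (extChartAt_target_mem_nhds_self p₀)
  have h2 : ContMDiffAt 𝓘(ℝ, E) 𝓘(ℝ, G) ∞ (f ∘ (extChartAt 𝓘(ℝ, E) p₀).symm)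
      (extChartAt 𝓘(ℝ, E) p₀ p₀) :=
    ContMDiffAt.comp _ (by rwa [extChartAt_to_inv]) h1
  exact h2.contDiffAt.differentiableAt (by simp)

theorem differentiableAt_metricCoord (g : Metric E N) (p₀ : N) :
    DifferentiableAt ℝ (metricCoord g p₀) (extChartAt 𝓘(ℝ, E) p₀ p₀) := by
  have h := differentiableAt_comp_extChartAt_symm ((contMDiffAt_hom_bundle _).1 (g.contMDiff p₀)).2
  refine h.congr_of_eventuallyEq ?_
  filter_upwards [extChartAt_target_mem_nhds_self p₀] with a ha
  have hs := (extChartAt 𝓘(ℝ, E) p₀).map_target ha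
  rw [extChartAt_source] at hs
  ext u v
  simp only [Function.comp_apply]
  rw [inCoordinates_apply_eq₂ (by exact hs) (by exact hs) (mem_univ _)]
  have hu (w : E) := DFunLike.congr_fun (chartFrame_eq_symmL ha) w
  refine (congrArg₂ (fun x y : E => metricAt g ((extChartAt 𝓘(ℝ, E) p₀).symm a) x y)
    (hu u).symm (hu v).symm).trans ?_
  simp only [Bundle.Trivial.linearMapAt_trivialization, Trivial.fiberBundle_trivializationAt',
    LinearMap.id_apply]
  rw [← Trivialization.symmL_apply (R := ℝ) _ (by exact hs),
    ← Trivialization.symmL_apply (R := ℝ) _ (by exact hs)]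
  rfl

/-- In a chart the magnetic form is the product of the Gram form and the matrix of the Lorentz
force. -/
theorem differentiableAt_formCoord {g : Metric E N} (F : LorentzForce g) (p₀ : N) :
    DifferentiableAt ℝ (formCoord F p₀) (extChartAt 𝓘(ℝ, E) p₀ p₀) := by
  have h := differentiableAt_comp_extChartAt_symm ((contMDiffAt_hom_bundle _).1 (F.smooth p₀)).2
  have hc := (differentiableAt_metricCoord g p₀).clm_comp h
  refine hc.congr_of_eventuallyEq ?_
  filter_upwards [extChartAt_target_mem_nhds_self p₀] with a ha
  have hs := (extChartAt 𝓘(ℝ, E) p₀).map_target ha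
  rw [extChartAt_source] at hs
  ext u v
  have hu (w : E) := DFunLike.congr_fun (chartFrame_eq_symmL ha) w
  rw [ContinuousLinearMap.comp_apply, metricCoord_apply, formCoord_apply, Function.comp_apply]
  refine congrArg
    (fun x : E => metricAt g ((extChartAt 𝓘(ℝ, E) p₀).symm a) x (chartFrame p₀ a v)) ?_
  refine Eq.trans ?_ (hu _)
  refine Eq.trans ?_ (Trivialization.symmL_continuousLinearMapAt (R := ℝ)
    (trivializationAt E (TangentSpace 𝓘(ℝ, E)) p₀) hs
    (F.toFun _ ((trivializationAt E (TangentSpace 𝓘(ℝ, E)) p₀).symmL ℝ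
      ((extChartAt 𝓘(ℝ, E) p₀).symm a) u))).symm
  exact congrArg (forceAt F _) (hu u).symm

theorem differentiableAt_fieldCoord [CompleteSpace E] {p₀ : N}
    {ξ : ∀ p : N, TangentSpace 𝓘(ℝ, E) p}
    (hξ : MDifferentiableAt 𝓘(ℝ, E) 𝓘(ℝ, E).tangent
      (fun p => (⟨p, ξ p⟩ : TangentBundle 𝓘(ℝ, E) N)) p₀) :
    DifferentiableAt ℝ (fieldCoord p₀ ξ) (extChartAt 𝓘(ℝ, E) p₀ p₀) := by
  have : DifferentiableWithinAt ℝ (fieldCoord p₀ ξ)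
      ((extChartAt 𝓘(ℝ, E) p₀).symm ⁻¹' univ ∩ range 𝓘(ℝ, E)) (extChartAt 𝓘(ℝ, E) p₀ p₀) :=
    (mdifferentiableWithinAt_univ.2 hξ).differentiableWithinAt_mpullbackWithin_vectorField
  rw [preimage_univ, univ_inter, modelWithCornersSelf_coe, range_id,
    differentiableWithinAt_univ] at this
  exact this

theorem mlieBracket_eq_lieBracket_fieldCoord (ξ₁ ξ₂ : ∀ p : N, TangentSpace 𝓘(ℝ, E) p) (p₀ : N) :
    (mlieBracket 𝓘(ℝ, E) ξ₁ ξ₂ p₀ : E) =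
      lieBracket (E := E) ℝ (fieldCoord p₀ ξ₁) (fieldCoord p₀ ξ₂) (extChartAt 𝓘(ℝ, E) p₀ p₀) := by
  have h : (mlieBracket 𝓘(ℝ, E) ξ₁ ξ₂ p₀ : E) =
      (mfderiv 𝓘(ℝ, E) 𝓘(ℝ, E) (extChartAt 𝓘(ℝ, E) p₀) p₀).inverse
        (lieBracketWithin (E := E) ℝ (fieldCoord p₀ ξ₁) (fieldCoord p₀ ξ₂)
          ((extChartAt 𝓘(ℝ, E) p₀).symm ⁻¹' univ ∩ range 𝓘(ℝ, E))
          (extChartAt 𝓘(ℝ, E) p₀ p₀)) := rfl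
  rw [h, preimage_univ, univ_inter, modelWithCornersSelf_coe, range_id, lieBracketWithin_univ,
    mfderiv_extChartAt_self]
  exact DFunLike.congr_fun (ContinuousLinearMap.inverse_id (R := ℝ) (M := E)) _

/-- The equation `df = g(Fξ, ·)`, read in the preferred chart at `p₀`. -/
theorem hasFDerivAt_potential_coord {g : Metric E N} {F : LorentzForce g}
    {ξ : ∀ p : N, TangentSpace 𝓘(ℝ, E) p} {f : N → ℝ} (hf : IsMagneticPotential F ξ f)
    {p₀ : N} {a : E} (ha : a ∈ (extChartAt 𝓘(ℝ, E) p₀).target) :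
    HasFDerivAt (fun y => f ((extChartAt 𝓘(ℝ, E) p₀).symm y))
      (formCoord F p₀ a (fieldCoord p₀ ξ a)) a := by
  have h := (hf ((extChartAt 𝓘(ℝ, E) p₀).symm a)).comp a (hasMFDerivAt_extChartAt_symm ha)
  refine (hasMFDerivAt_iff_hasFDerivAt.1 h).congr_fderiv ?_
  refine ContinuousLinearMap.ext fun u : E => ?_
  exact (congrArg (fun x : E => metricAt g ((extChartAt 𝓘(ℝ, E) p₀).symm a)
    (forceAt F ((extChartAt 𝓘(ℝ, E) p₀).symm a) x) (chartFrame p₀ a u))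
    (chartFrame_fieldCoord ha ξ)).symm

/-- Closedness of the magnetic form, read in the preferred chart. -/
theorem formCoord_closed {g : Metric E N} (F : LorentzForce g) (p₀ : N) (u v w : E) :
    fderiv ℝ (formCoord F p₀) (extChartAt 𝓘(ℝ, E) p₀ p₀) u v w
      - fderiv ℝ (formCoord F p₀) (extChartAt 𝓘(ℝ, E) p₀ p₀) v u w
      + fderiv ℝ (formCoord F p₀) (extChartAt 𝓘(ℝ, E) p₀ p₀) w u v = 0 := by
  rw [← extDeriv_twoForm_apply (differentiableAt_formCoord F p₀) (formCoord_skew F p₀)]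
  have h := DFunLike.congr_fun (congr_fun F.closed p₀)
    (![u, v, w] : Fin 3 → TangentSpace 𝓘(ℝ, E) p₀)
  unfold mextDeriv at h
  rw [modelWithCornersSelf_coe, range_id, extDerivWithin_univ, mfderiv_extChartAt_self] at h
  have hform : (fun y : E => twoForm (formCoord F p₀ y) (formCoord_skew F p₀ y)) =
    fun y : E => (F.form ((extChartAt 𝓘(ℝ, E) p₀).symm y)).compContinuousLinearMap
      (chartFrame (E := E) p₀ y) := rfl
  rw [hform]
  unfold chartFrame
  rw [modelWithCornersSelf_coe, range_id]
  exact h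

end Charts

/-! ### The tangent bundle in a chart -/

section TangentChart
set_option maxSynthPendingDepth 3
open VectorField Filter Topology
variable {E : Type*} [NormedAddCommGroup E] [NormedSpace ℝ E]
  {N : Type*} [TopologicalSpace N] [ChartedSpace E N] [IsManifold 𝓘(ℝ, E) ∞ N]

theorem mem_extChartAt_tangent_target {v : TangentBundle 𝓘(ℝ, E) N} {y : E × E} :
    y ∈ (extChartAt 𝓘(ℝ, E).tangent v).target ↔ y.1 ∈ (extChartAt 𝓘(ℝ, E) v.proj).target := by
  rw [FiberBundle.extChartAt_target]
  simp only [mem_prod, mem_univ, and_true, mem_inter_iff, mem_preimage,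
    TangentBundle.trivializationAt_baseSet, and_iff_left_iff_imp]
  intro h
  simpa [extChartAt_source] using (extChartAt 𝓘(ℝ, E) v.proj).map_target h

/-- The inverse chart of `TN` at `v` sends `(a, b)` to the vector with components `b` in the
coordinate frame over the point with coordinates `a`. -/
theorem extChartAt_tangent_symm_apply {v : TangentBundle 𝓘(ℝ, E) N} {y : E × E}
    (hy : y.1 ∈ (extChartAt 𝓘(ℝ, E) v.proj).target) :
    (extChartAt 𝓘(ℝ, E).tangent v).symm y =
      ⟨(extChartAt 𝓘(ℝ, E) v.proj).symm y.1, chartFrame v.proj y.1 y.2⟩ := by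
  have hs := (extChartAt 𝓘(ℝ, E) v.proj).map_target hy
  rw [extChartAt_source] at hs
  rw [FiberBundle.extChartAt]
  have hu := DFunLike.congr_fun (chartFrame_eq_symmL hy) y.2
  refine Eq.trans ?_ (congrArg (fun b : E =>
    (⟨(extChartAt 𝓘(ℝ, E) v.proj).symm y.1, b⟩ : TangentBundle 𝓘(ℝ, E) N))
    ((Trivialization.symmL_apply (R := ℝ) _ (by exact hs) y.2).symm.trans hu))
  refine Eq.trans ?_ ((trivializationAt E (TangentSpace 𝓘(ℝ, E)) v.proj).mk_symm hs y.2).symm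
  rfl

theorem extChartAt_tangent_self (v : TangentBundle 𝓘(ℝ, E) N) :
    extChartAt 𝓘(ℝ, E).tangent v v = (extChartAt 𝓘(ℝ, E) v.proj v.proj, v.snd) := by
  have h := (extChartAt 𝓘(ℝ, E).tangent v).right_inv
    (x := (extChartAt 𝓘(ℝ, E) v.proj v.proj, v.snd))
    (mem_extChartAt_tangent_target.2 (mem_extChartAt_target v.proj))
  rw [extChartAt_tangent_symm_apply (mem_extChartAt_target v.proj), chartFrame_self] at h
  refine Eq.trans (congrArg _ ?_) h
  have : ∀ (q : N), q = v.proj → (⟨q, v.snd⟩ : TangentBundle 𝓘(ℝ, E) N) = v := by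
    rintro _ rfl; rfl
  exact (this _ (extChartAt_to_inv v.proj)).symm

theorem eventually_extChartAt_tangent_target (v : TangentBundle 𝓘(ℝ, E) N) :
    ∀ᶠ y : E × E in 𝓝 (extChartAt 𝓘(ℝ, E).tangent v v),
      y.1 ∈ (extChartAt 𝓘(ℝ, E) v.proj).target := by
  filter_upwards [extChartAt_target_mem_nhds (I := 𝓘(ℝ, E).tangent) v] with y hy
  exact mem_extChartAt_tangent_target.1 hy

/-- The differential of the inverse chart of `TN` at `v`, at the coordinate point `y`. -/
def tangentFrame (v : TangentBundle 𝓘(ℝ, E) N) (y : E × E) : E × E →L[ℝ] E × E :=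
  mfderivWithin 𝓘(ℝ, E × E) 𝓘(ℝ, E).tangent (extChartAt 𝓘(ℝ, E).tangent v).symm
    (range 𝓘(ℝ, E).tangent) y

/-- The differential of the projection `TN → N`, as a map of model spaces. -/
def dprojAt (w : TangentBundle 𝓘(ℝ, E) N) : E × E →L[ℝ] E := dproj w

/-- In the chart of `TN` at `v`, the projection `TN → N` is the first projection. -/
theorem dprojAt_comp_tangentFrame {v : TangentBundle 𝓘(ℝ, E) N} {y : E × E}
    (hy : y.1 ∈ (extChartAt 𝓘(ℝ, E) v.proj).target) (U : E × E) :
    dprojAt ((extChartAt 𝓘(ℝ, E).tangent v).symm y) (tangentFrame v y U) =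
      chartFrame v.proj y.1 U.1 := by
  have h1 : HasMFDerivWithinAt 𝓘(ℝ, E × E) 𝓘(ℝ, E).tangent
      (extChartAt 𝓘(ℝ, E).tangent v).symm (range 𝓘(ℝ, E).tangent) y
      (tangentFrame (E := E) v y) :=
    (mdifferentiableWithinAt_extChartAt_symm
      (mem_extChartAt_tangent_target.2 hy)).hasMFDerivWithinAt
  have h2 : HasMFDerivAt 𝓘(ℝ, E).tangent 𝓘(ℝ, E)
      (fun w : TangentBundle 𝓘(ℝ, E) N => w.proj) ((extChartAt 𝓘(ℝ, E).tangent v).symm y)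
      (dproj ((extChartAt 𝓘(ℝ, E).tangent v).symm y)) :=
    ((contMDiff_proj (n := 1) (TangentSpace 𝓘(ℝ, E))).mdifferentiable one_ne_zero _).hasMFDerivAt
  have h3 := h2.comp_hasMFDerivWithinAt y h1
  have hr : range 𝓘(ℝ, E).tangent = univ := by simp
  rw [hr] at h3
  have h3 := hasMFDerivWithinAt_univ.1 h3
  have h4 : HasMFDerivAt 𝓘(ℝ, E × E) 𝓘(ℝ, E) (fun z : E × E => z.1) y
      (ContinuousLinearMap.fst ℝ E E) := hasFDerivAt_fst.hasMFDerivAt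
  have h5 := (hasMFDerivAt_extChartAt_symm hy).comp y h4
  have h6 : (fun w : TangentBundle 𝓘(ℝ, E) N => w.proj) ∘ (extChartAt 𝓘(ℝ, E).tangent v).symm
      =ᶠ[𝓝 y] (extChartAt 𝓘(ℝ, E) v.proj).symm ∘ fun z : E × E => z.1 := by
    filter_upwards [(isOpen_extChartAt_target v.proj).preimage continuous_fst |>.mem_nhds hy]
      with z hz
    simp only [Function.comp_apply]
    rw [extChartAt_tangent_symm_apply hz]
  exact DFunLike.congr_fun (hasMFDerivAt_unique h3 (h5.congr_of_eventuallyEq h6)) U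

theorem tangentFrame_self (v : TangentBundle 𝓘(ℝ, E) N) :
    tangentFrame v (extChartAt 𝓘(ℝ, E).tangent v v) = ContinuousLinearMap.id ℝ (E × E) :=
  mfderivWithin_range_extChartAt_symm

theorem dprojAt_apply (v : TangentBundle 𝓘(ℝ, E) N) (U : E × E) : dprojAt v U = U.1 := by
  have h := dprojAt_comp_tangentFrame (v := v) (y := extChartAt 𝓘(ℝ, E).tangent v v)
    (eventually_extChartAt_tangent_target v).self_of_nhds U
  rw [tangentFrame_self, extChartAt_to_inv, extChartAt_tangent_self, chartFrame_self] at h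
  exact h

/-- The tautological form in the chart of `TN` at `v`. -/
theorem tautological_coord (g : Metric E N) (v : TangentBundle 𝓘(ℝ, E) N) :
    (fun y : E × E =>
      (tautological g ((extChartAt 𝓘(ℝ, E).tangent v).symm y)).compContinuousLinearMap
        (tangentFrame (E := E) v y)) =ᶠ[𝓝 (extChartAt 𝓘(ℝ, E).tangent v v)]
    fun y : E × E => ContinuousAlternatingMap.ofSubsingleton ℝ (E × E) ℝ (0 : Fin 1)
        ((metricCoord g v.proj y.1 y.2).comp (ContinuousLinearMap.fst ℝ E E)) := by
  filter_upwards [eventually_extChartAt_tangent_target v] with y hy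
  ext U
  have h (w : TangentBundle 𝓘(ℝ, E) N) (X : E × E) (Y : E) (q : N) (b : E) (hw : w = ⟨q, b⟩)
      (hX : dprojAt w X = Y) : metricAt g w.proj w.snd (dprojAt w X) = metricAt g q b Y := by
    subst hw; rw [hX]
  exact h _ (tangentFrame v y (U 0)) _ _ _ (extChartAt_tangent_symm_apply hy)
    (dprojAt_comp_tangentFrame hy (U 0))

/-- The twisted form at `v`, in the coordinates of the chart of `TN` at `v`. These coordinates
introduce no transition map, since the chart has identity differential at its base point. -/
theorem twistedForm_apply {g : Metric E N} (F : LorentzForce g) (v : TangentBundle 𝓘(ℝ, E) N)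
    (U V : E × E) :
    twistedForm F v (![U, V] : Fin 2 → E × E) =
      -(fderiv ℝ (metricCoord g v.proj) (extChartAt 𝓘(ℝ, E) v.proj v.proj) U.1 v.snd V.1
          + metricAt g v.proj U.2 V.1
        - (fderiv ℝ (metricCoord g v.proj) (extChartAt 𝓘(ℝ, E) v.proj v.proj) V.1 v.snd U.1
          + metricAt g v.proj V.2 U.1))
      + ((metricAt g v.proj).comp (forceAt F v.proj)) U.1 V.1 := by
  have h1 : mextDeriv 𝓘(ℝ, E).tangent (tautological g) v (![U, V] : Fin 2 → E × E) =
      fderiv ℝ (metricCoord g v.proj) (extChartAt 𝓘(ℝ, E) v.proj v.proj) U.1 v.snd V.1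
          + metricAt g v.proj U.2 V.1
        - (fderiv ℝ (metricCoord g v.proj) (extChartAt 𝓘(ℝ, E) v.proj v.proj) V.1 v.snd U.1
          + metricAt g v.proj V.2 U.1) := by
    have hd := extDeriv_tautological_apply (y := extChartAt 𝓘(ℝ, E).tangent v v)
      (G := metricCoord g v.proj)
      (by rw [extChartAt_tangent_self]; exact differentiableAt_metricCoord g v.proj) U V
    rw [← (tautological_coord g v).extDeriv_eq] at hd
    rw [extChartAt_tangent_self v] at hd
    simp only [metricCoord_self] at hd
    rw [← extChartAt_tangent_self v, ← extDerivWithin_univ] at hd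
    rw [← hd]
    unfold mextDeriv
    rw [mfderiv_extChartAt_self]
    have hr : range 𝓘(ℝ, E).tangent = univ := by simp
    rw [hr]
    unfold tangentFrame
    rw [hr]
    rfl
  have h2 : ((F.form v.proj).compContinuousLinearMap (dproj v)) (![U, V] : Fin 2 → E × E) =
      ((metricAt g v.proj).comp (forceAt F v.proj)) U.1 V.1 := by
    have : ∀ X Y : E, X = U.1 → Y = V.1 →
        metricAt g v.proj (forceAt F v.proj X) Y =
        ((metricAt g v.proj).comp (forceAt F v.proj)) U.1 V.1 := by rintro _ _ rfl rfl; rfl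
    exact this _ _ (dprojAt_apply v U) (dprojAt_apply v V)
  rw [← h1, ← h2]
  rfl

/-- The differential of a momentum function at `v`, in the coordinates of the chart of `TN`
at `v`. -/
theorem hasMFDerivAt_momentum [CompleteSpace E] {g : Metric E N} {F : LorentzForce g}
    {ξ : ∀ p : N, TangentSpace 𝓘(ℝ, E) p} {f : N → ℝ} (hf : IsMagneticPotential F ξ f)
    (hξ : MDifferentiable 𝓘(ℝ, E) 𝓘(ℝ, E).tangent
      (fun p => (⟨p, ξ p⟩ : TangentBundle 𝓘(ℝ, E) N))) (v : TangentBundle 𝓘(ℝ, E) N) :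
    ∃ l : E × E →L[ℝ] ℝ, HasMFDerivAt 𝓘(ℝ, E).tangent 𝓘(ℝ, ℝ) (momentum g ξ f) v
        (l : E × E →L[ℝ] ℝ) ∧
      ∀ U, l U =
        fderiv ℝ (metricCoord g v.proj) (extChartAt 𝓘(ℝ, E) v.proj v.proj) U.1 (ξ v.proj) v.snd
        + metricAt g v.proj (fderiv ℝ (fieldCoord v.proj ξ)
            (extChartAt 𝓘(ℝ, E) v.proj v.proj) U.1) v.snd
        + metricAt g v.proj (ξ v.proj) U.2
        + ((metricAt g v.proj).comp (forceAt F v.proj)) (ξ v.proj) U.1 := by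
  have hp := hasFDerivAt_potential_coord hf (mem_extChartAt_target v.proj)
  obtain ⟨l, hl, hlU⟩ := fderiv_momentum_coord (y := extChartAt 𝓘(ℝ, E).tangent v v)
    (G := metricCoord g v.proj) (X := fieldCoord v.proj ξ)
    (h := fun y => f ((extChartAt 𝓘(ℝ, E) v.proj).symm y))
    (α := formCoord F v.proj (extChartAt 𝓘(ℝ, E) v.proj v.proj)
      (fieldCoord v.proj ξ (extChartAt 𝓘(ℝ, E) v.proj v.proj)))
    (by rw [extChartAt_tangent_self]; exact differentiableAt_metricCoord g v.proj)
    (by rw [extChartAt_tangent_self]; exact differentiableAt_fieldCoord (hξ v.proj))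
    (by rw [extChartAt_tangent_self]; exact hp)
  refine ⟨l, ?_, fun U => ?_⟩
  · have h1 : HasMFDerivAt 𝓘(ℝ, E).tangent 𝓘(ℝ, E × E) (extChartAt 𝓘(ℝ, E).tangent v) v
        (ContinuousLinearMap.id ℝ (E × E)) := by
      have := (mdifferentiableAt_extChartAt (I := 𝓘(ℝ, E).tangent)
        (mem_chart_source _ v)).hasMFDerivAt
      rwa [mfderiv_extChartAt_self] at this
    have h2 := hl.hasMFDerivAt.comp v h1
    refine HasMFDerivAt.congr_of_eventuallyEq (f := _) (f' := l) h2 ?_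
    have hc := (continuousAt_extChartAt (I := 𝓘(ℝ, E).tangent) v).eventually
      (eventually_extChartAt_tangent_target v)
    filter_upwards [hc, extChartAt_source_mem_nhds (I := 𝓘(ℝ, E).tangent) v] with w hw hws
    have hwe := extChartAt_tangent_symm_apply hw
    rw [(extChartAt 𝓘(ℝ, E).tangent v).left_inv hws] at hwe
    have hm : ∀ (w : TangentBundle 𝓘(ℝ, E) N) (q : N) (b X : E), w = ⟨q, b⟩ → X = ξ q →
        momentum g ξ f w = metricAt g q X b + f q := by rintro _ _ _ _ rfl rfl; rfl
    rw [hm _ _ _ _ hwe (chartFrame_fieldCoord hw ξ)]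
    rfl
  · rw [hlU, extChartAt_tangent_self]
    simp only [metricCoord_self, fieldCoord_self, formCoord_self]

end TangentChart

/-! ### Stationarity of the magnetic form on commuting fields -/

section Constancy
set_option maxSynthPendingDepth 3
open VectorField Filter Topology
variable {E : Type*} [NormedAddCommGroup E] [NormedSpace ℝ E]
  {N : Type*} [TopologicalSpace N] [ChartedSpace E N] [IsManifold 𝓘(ℝ, E) ∞ N]

/-- A function on a connected manifold with vanishing differential is constant. -/
theorem eq_of_hasMFDerivAt_zero [PreconnectedSpace N] {h : N → ℝ}
    (hh : ∀ p, HasMFDerivAt 𝓘(ℝ, E) 𝓘(ℝ, ℝ) h p (0 : E →L[ℝ] ℝ)) (p q : N) : h p = h q := by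
  have hloc : IsLocallyConstant h := by
    rw [IsLocallyConstant.iff_eventually_eq]
    intro p₀
    obtain ⟨r, hr, hball⟩ := Metric.mem_nhds_iff.1 (extChartAt_target_mem_nhds_self (E := E) p₀)
    have hd : ∀ a ∈ Metric.ball (extChartAt 𝓘(ℝ, E) p₀ p₀) r,
        HasFDerivAt (h ∘ (extChartAt 𝓘(ℝ, E) p₀).symm) (0 : E →L[ℝ] ℝ) a := by
      intro a ha
      have h2 := (hh _).comp a (hasMFDerivAt_extChartAt_symm (hball ha))
      exact (hasMFDerivAt_iff_hasFDerivAt.1 h2).congr_fderiv (ContinuousLinearMap.zero_comp _)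
    have hc := (continuousAt_extChartAt (I := 𝓘(ℝ, E)) p₀).eventually (Metric.ball_mem_nhds _ hr)
    filter_upwards [hc, extChartAt_source_mem_nhds (I := 𝓘(ℝ, E)) p₀] with x hx hxs
    have := (convex_ball (extChartAt 𝓘(ℝ, E) p₀ p₀) r).is_const_of_fderivWithin_eq_zero (𝕜 := ℝ)
      (fun a ha => (hd a ha).differentiableAt.differentiableWithinAt)
      (fun a ha => by
        rw [fderivWithin_of_isOpen Metric.isOpen_ball ha]; exact (hd a ha).fderiv)
      hx (Metric.mem_ball_self hr)
    simpa only [Function.comp_apply, (extChartAt 𝓘(ℝ, E) p₀).left_inv hxs, extChartAt_to_inv]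
      using this
  exact hloc.apply_eq_of_preconnectedSpace p q

/-- If `ξ₁` and `ξ₂` admit magnetic potentials and commute at `p₀`, then `ω^F(ξ₁, ξ₂)` is stationary
at `p₀`. -/
theorem hasMFDerivAt_form_zero [CompleteSpace E] {g : Metric E N} {F : LorentzForce g}
    {ξ₁ ξ₂ : ∀ p : N, TangentSpace 𝓘(ℝ, E) p} {f₁ f₂ : N → ℝ}
    (hf₁ : IsMagneticPotential F ξ₁ f₁) (hf₂ : IsMagneticPotential F ξ₂ f₂) {p₀ : N}
    (hξ₁ : MDifferentiableAt 𝓘(ℝ, E) 𝓘(ℝ, E).tangent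
      (fun p => (⟨p, ξ₁ p⟩ : TangentBundle 𝓘(ℝ, E) N)) p₀)
    (hξ₂ : MDifferentiableAt 𝓘(ℝ, E) 𝓘(ℝ, E).tangent
      (fun p => (⟨p, ξ₂ p⟩ : TangentBundle 𝓘(ℝ, E) N)) p₀)
    (hcomm : mlieBracket 𝓘(ℝ, E) ξ₁ ξ₂ p₀ = 0) :
    HasMFDerivAt 𝓘(ℝ, E) 𝓘(ℝ, ℝ) (fun p => metricAt g p (forceAt F p (ξ₁ p)) (ξ₂ p)) p₀
      (0 : E →L[ℝ] ℝ) := by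
  have hev : ∀ᶠ a in 𝓝 (extChartAt 𝓘(ℝ, E) p₀ p₀), a ∈ (extChartAt 𝓘(ℝ, E) p₀).target :=
    extChartAt_target_mem_nhds_self p₀
  have h := hasFDerivAt_zero_of_closed (differentiableAt_formCoord F p₀)
    (differentiableAt_fieldCoord hξ₁) (differentiableAt_fieldCoord hξ₂) (formCoord_skew F p₀)
    (formCoord_closed F p₀) (hev.mono fun a ha => hasFDerivAt_potential_coord hf₁ ha)
    (hev.mono fun a ha => hasFDerivAt_potential_coord hf₂ ha)
    ((mlieBracket_eq_lieBracket_fieldCoord ξ₁ ξ₂ p₀).symm.trans hcomm)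
  have h1 := (mdifferentiableAt_extChartAt (I := 𝓘(ℝ, E)) (mem_chart_source E p₀)).hasMFDerivAt
  have h2 := h.hasMFDerivAt.comp p₀ h1
  have h3 : HasMFDerivAt 𝓘(ℝ, E) 𝓘(ℝ, ℝ) ((fun y => formCoord F p₀ y (fieldCoord p₀ ξ₁ y)
      (fieldCoord p₀ ξ₂ y)) ∘ extChartAt 𝓘(ℝ, E) p₀) p₀ (0 : E →L[ℝ] ℝ) := by
    convert! h2 using 1
  refine h3.congr_of_eventuallyEq ?_
  filter_upwards [extChartAt_source_mem_nhds (I := 𝓘(ℝ, E)) p₀] with p hp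
  have ht := (extChartAt 𝓘(ℝ, E) p₀).map_source hp
  have hq := (extChartAt 𝓘(ℝ, E) p₀).left_inv hp
  have e : ∀ (q : N) (X Y : E), q = p → X = ξ₁ q → Y = ξ₂ q →
      metricAt g p (forceAt F p (ξ₁ p)) (ξ₂ p) = metricAt g q (forceAt F q X) Y := by
    rintro _ _ _ rfl rfl rfl; rfl
  exact e _ _ _ hq (chartFrame_fieldCoord ht ξ₁) (chartFrame_fieldCoord ht ξ₂)

end Constancy

/-! ### Nondegeneracy and the bracket of momentum functions -/

section Hamiltonian
set_option maxSynthPendingDepth 3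
open VectorField Filter Topology
variable {E : Type*} [NormedAddCommGroup E] [NormedSpace ℝ E]
  {N : Type*} [TopologicalSpace N] [ChartedSpace E N] [IsManifold 𝓘(ℝ, E) ∞ N]

theorem isNondegenerate_twistedForm {g : Metric E N} (F : LorentzForce g) :
    IsNondegenerate (twistedForm F) := by
  intro v X hX
  exact nondegenerate_coord (eq_zero_of_metricAt_self g v.proj) (X := (X : E × E))
    (fun V => (twistedForm_apply F v X V).symm.trans (hX V))

/-- The defining equation of the Hamiltonian vector field. It holds for every `φ`, since `mfderiv`
is a linear functional in any case. -/
theorem hamiltonianVectorField_spec [FiniteDimensional ℝ E] {g : Metric E N} (F : LorentzForce g)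
    (φ : TangentBundle 𝓘(ℝ, E) N → ℝ) (v : TangentBundle 𝓘(ℝ, E) N)
    (U : TangentSpace 𝓘(ℝ, E).tangent v) :
    twistedForm F v ![hamiltonianVectorField (twistedForm F) φ v, U] =
      mfderiv 𝓘(ℝ, E).tangent 𝓘(ℝ, ℝ) φ v U := by
  have h : ∃ X : TangentSpace 𝓘(ℝ, E).tangent v, ∀ U : TangentSpace 𝓘(ℝ, E).tangent v,
      twistedForm F v ![X, U] = (mfderiv 𝓘(ℝ, E).tangent 𝓘(ℝ, ℝ) φ v U : ℝ) :=
    exists_alternating_two_eq (V := E × E) (twistedForm F v) (isNondegenerate_twistedForm F v)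
      (mfderiv 𝓘(ℝ, E).tangent 𝓘(ℝ, ℝ) φ v)
  exact Classical.epsilon_spec h U

/-- The bracket of two momentum functions is minus the momentum of the bracket of the fields, up to
the magnetic term `ω^F(ξ₁, ξ₂)`. -/
theorem poissonBracket_momentum [FiniteDimensional ℝ E] {g : Metric E N} {F : LorentzForce g}
    {ξ₁ ξ₂ : ∀ p : N, TangentSpace 𝓘(ℝ, E) p} {f₁ f₂ : N → ℝ}
    (hf₁ : IsMagneticPotential F ξ₁ f₁) (hf₂ : IsMagneticPotential F ξ₂ f₂)
    (hξ₁ : MDifferentiable 𝓘(ℝ, E) 𝓘(ℝ, E).tangent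
      (fun p => (⟨p, ξ₁ p⟩ : TangentBundle 𝓘(ℝ, E) N)))
    (hξ₂ : MDifferentiable 𝓘(ℝ, E) 𝓘(ℝ, E).tangent
      (fun p => (⟨p, ξ₂ p⟩ : TangentBundle 𝓘(ℝ, E) N))) (v : TangentBundle 𝓘(ℝ, E) N) :
    poissonBracket (twistedForm F) (momentum g ξ₁ f₁) (momentum g ξ₂ f₂) v =
      metricAt g v.proj (forceAt F v.proj (ξ₁ v.proj)) (ξ₂ v.proj)
        - metricAt g v.proj (mlieBracket 𝓘(ℝ, E) ξ₁ ξ₂ v.proj) v.snd := by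
  have : CompleteSpace E := FiniteDimensional.complete ℝ E
  obtain ⟨l₁, hl₁, hlU₁⟩ := hasMFDerivAt_momentum hf₁ hξ₁ v
  obtain ⟨l₂, hl₂, hlU₂⟩ := hasMFDerivAt_momentum hf₂ hξ₂ v
  have hD (z u w : E) :
      fderiv ℝ (metricCoord g v.proj) (extChartAt 𝓘(ℝ, E) v.proj v.proj) z u w =
        fderiv ℝ (metricCoord g v.proj) (extChartAt 𝓘(ℝ, E) v.proj v.proj) z w u := by
    have hG := (differentiableAt_metricCoord g v.proj).hasFDerivAt
    have d (x y : E) := (hG.clm_apply (hasFDerivAt_const x _)).clm_apply (hasFDerivAt_const y _)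
    have := d u w
    simp only [metricCoord_symm g v.proj _ u w] at this
    simpa using DFunLike.congr_fun (this.unique (d w u)) z
  have hb := bracket_momentum_coord (G := metricAt g v.proj)
    (Ω := fun U V => twistedForm F v (![U, V] : Fin 2 → E × E)) (l₁ := l₁) (l₂ := l₂)
    (X₁ := hamiltonianVectorField (twistedForm F) (momentum g ξ₁ f₁) v)
    (X₂ := hamiltonianVectorField (twistedForm F) (momentum g ξ₂ f₂) v)
    (metricAt_symm g v.proj) hD (eq_zero_of_metricAt_self g v.proj) (twistedForm_apply F v)
    hlU₁ hlU₂
    (fun U => (hamiltonianVectorField_spec F _ v U).trans (DFunLike.congr_fun hl₁.mfderiv U))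
    (fun U => (hamiltonianVectorField_spec F _ v U).trans (DFunLike.congr_fun hl₂.mfderiv U))
  refine Eq.trans hb ?_
  have hl : lieBracket (E := E) ℝ (fieldCoord v.proj ξ₁) (fieldCoord v.proj ξ₂)
      (extChartAt 𝓘(ℝ, E) v.proj v.proj) =
      fderiv ℝ (fieldCoord v.proj ξ₂) (extChartAt 𝓘(ℝ, E) v.proj v.proj) (ξ₁ v.proj)
        - fderiv ℝ (fieldCoord v.proj ξ₁) (extChartAt 𝓘(ℝ, E) v.proj v.proj) (ξ₂ v.proj) := by
    simp only [lieBracket_eq, fieldCoord_self]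
  have hbr := (mlieBracket_eq_lieBracket_fieldCoord ξ₁ ξ₂ v.proj).trans hl
  exact congrArg (fun x : E => metricAt g v.proj (forceAt F v.proj (ξ₁ v.proj)) (ξ₂ v.proj)
        - metricAt g v.proj x v.snd) hbr.symm

end Hamiltonian

/-! ### Right-invariant vector fields -/

section RightInvariant
set_option maxSynthPendingDepth 3
open VectorField
variable {E : Type*} [NormedAddCommGroup E] [NormedSpace ℝ E]
  {N : Type*} [TopologicalSpace N] [ChartedSpace E N] [Group N] [LieGroup 𝓘(ℝ, E) ∞ N]

/-- The differential at `p` of a self-map of `N`, as an endomorphism of the model space. -/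
def differentialAt (f : N → N) (p : N) : E →L[ℝ] E := mfderiv 𝓘(ℝ, E) 𝓘(ℝ, E) f p

theorem differentialAt_comp {f f' : N → N} {p : N}
    (hf' : MDifferentiableAt 𝓘(ℝ, E) 𝓘(ℝ, E) f' (f p))
    (hf : MDifferentiableAt 𝓘(ℝ, E) 𝓘(ℝ, E) f p) :
    differentialAt (E := E) (f' ∘ f) p = (differentialAt f' (f p)).comp (differentialAt f p) :=
  mfderiv_comp p hf' hf

theorem differentialAt_id (p : N) :
    differentialAt (E := E) (id : N → N) p = ContinuousLinearMap.id ℝ E :=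
  mfderiv_id

theorem mdifferentiable_inv : MDifferentiable 𝓘(ℝ, E) 𝓘(ℝ, E) (fun q : N => q⁻¹) :=
  (contMDiff_inv 𝓘(ℝ, E) ∞).mdifferentiable (by simp)

theorem differentialAt_inv_comp (p : N) :
    (differentialAt (E := E) (fun q : N => q⁻¹) p⁻¹).comp (differentialAt (fun q : N => q⁻¹) p) =
      ContinuousLinearMap.id ℝ E := by
  have h : (fun q : N => q⁻¹) ∘ (fun q : N => q⁻¹) = id := by ext; simp
  rw [← differentialAt_id p, ← h, differentialAt_comp (mdifferentiable_inv _)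
    (mdifferentiable_inv _)]

/-- Inversion has differential `-1` at the identity: differentiate `q * q⁻¹ = 1`. -/
theorem differentialAt_inv_one (u : E) :
    differentialAt (E := E) (fun q : N => q⁻¹) 1 u = -u := by
  have hinv := mdifferentiable_inv (E := E) (N := N)
  have hG := (hasMFDerivAt_id (I := 𝓘(ℝ, E)) (1 : N)).prodMk (hinv 1).hasMFDerivAt
  have hF : MDifferentiableAt (𝓘(ℝ, E).prod 𝓘(ℝ, E)) 𝓘(ℝ, E) (fun q : N × N => q.1 * q.2)
      (1, 1⁻¹) := (contMDiff_mul 𝓘(ℝ, E) ∞).mdifferentiable (by simp) _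
  have h1 := hF.hasMFDerivAt.comp (1 : N) hG
  have hconst : (fun q : N × N => q.1 * q.2) ∘ (fun q : N => (id q, q⁻¹)) = fun _ => 1 := by
    ext; simp
  rw [hconst] at h1
  have h2 : (0 : E) = differentialAt (E := E) (fun q : N => q * 1⁻¹) 1 u
      + differentialAt (E := E) (fun q : N => 1 * q) 1⁻¹
        (differentialAt (fun q : N => q⁻¹) 1 u) :=
    (DFunLike.congr_fun (hasMFDerivAt_unique (hasMFDerivAt_const 1 (1 : N)) h1) u).trans
      (mfderiv_prod_eq_add_apply hF)
  have e1 : (fun q : N => q * 1⁻¹) = id := by ext; simp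
  have e2 : (fun q : N => 1 * q) = id := by ext; simp
  rw [e1, e2, differentialAt_id, differentialAt_id] at h2
  exact (neg_eq_of_add_eq_zero_right h2.symm).symm

theorem differentialAt_inv_rightInvariantField (ξ : GroupLieAlgebra 𝓘(ℝ, E) N) (p : N) :
    differentialAt (E := E) (fun q : N => q⁻¹) p (rightInvariantField ξ p) =
      -(mulInvariantVectorField ξ p⁻¹ : E) := by
  have hR : MDifferentiable 𝓘(ℝ, E) 𝓘(ℝ, E) (fun q : N => q * p) :=
    (contMDiff_mul_right (n := ∞)).mdifferentiable (by simp)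
  have hL : MDifferentiable 𝓘(ℝ, E) 𝓘(ℝ, E) (fun q : N => p⁻¹ * q) :=
    (contMDiff_mul_left (n := ∞)).mdifferentiable (by simp)
  -- `(q * p)⁻¹ = p⁻¹ * q⁻¹`, differentiated at the identity.
  have h : (fun q : N => q⁻¹) ∘ (fun q : N => q * p) =
      (fun q : N => p⁻¹ * q) ∘ (fun q : N => q⁻¹) := by ext; simp
  have h1 : differentialAt (E := E) ((fun q : N => q⁻¹) ∘ (fun q : N => q * p)) 1 =
      differentialAt ((fun q : N => p⁻¹ * q) ∘ (fun q : N => q⁻¹)) 1 := by rw [h]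
  rw [differentialAt_comp (mdifferentiable_inv _) (hR _),
    differentialAt_comp (hL _) (mdifferentiable_inv _), one_mul, inv_one] at h1
  have h2 (u : E) : differentialAt (E := E) (fun q : N => q⁻¹) p
      (differentialAt (fun q : N => q * p) 1 u) =
      -differentialAt (E := E) (fun q : N => p⁻¹ * q) 1 u := by
    have := DFunLike.congr_fun h1 u
    rwa [ContinuousLinearMap.comp_apply, ContinuousLinearMap.comp_apply, differentialAt_inv_one,
      map_neg] at this
  exact h2 ξ

/-- Inversion carries the left-invariant field of `-ξ` to the right-invariant field of `ξ`. -/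
theorem mpullback_inv_mulInvariantVectorField (ξ : GroupLieAlgebra 𝓘(ℝ, E) N) :
    mpullback 𝓘(ℝ, E) 𝓘(ℝ, E) (fun q : N => q⁻¹) (mulInvariantVectorField (-ξ)) =
      rightInvariantField ξ := by
  ext p
  have h1 := differentialAt_inv_comp (E := E) p
  have h2 := differentialAt_inv_comp (E := E) p⁻¹
  rw [inv_inv] at h2
  have h3 : (mulInvariantVectorField (-ξ) p⁻¹ : E) = -(mulInvariantVectorField ξ p⁻¹ : E) :=
    map_neg (differentialAt (E := E) (fun q : N => p⁻¹ * q) 1) ξ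
  have h4 := ContinuousLinearMap.inverse_eq h2 h1
  have h5 : (mpullback 𝓘(ℝ, E) 𝓘(ℝ, E) (fun q : N => q⁻¹) (mulInvariantVectorField (-ξ)) p : E) =
    (differentialAt (E := E) (fun q : N => q⁻¹) p).inverse
      (mulInvariantVectorField (-ξ) p⁻¹ : E) := rfl
  refine h5.trans ?_
  rw [h4, h3]
  have h6 := differentialAt_inv_rightInvariantField ξ p
  refine (congrArg (differentialAt (E := E) (fun q : N => q⁻¹) p⁻¹) h6.symm).trans ?_
  exact DFunLike.congr_fun h1 _

theorem rightInvariantField_one (ξ : GroupLieAlgebra 𝓘(ℝ, E) N) :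
    rightInvariantField ξ 1 = ξ := by
  have e : (fun q : N => q * 1) = id := by ext; simp
  have h : differentialAt (E := E) (fun q : N => q * 1) 1 ξ = ξ := by
    rw [e, differentialAt_id]; rfl
  exact h

theorem mdifferentiable_rightInvariantField [CompleteSpace E] (ξ : GroupLieAlgebra 𝓘(ℝ, E) N) :
    MDifferentiable 𝓘(ℝ, E) 𝓘(ℝ, E).tangent
      (fun p => (⟨p, rightInvariantField ξ p⟩ : TangentBundle 𝓘(ℝ, E) N)) := by
  have : LieGroup 𝓘(ℝ, E) (minSmoothness ℝ 3) N := .of_le (n := ∞) (by simp; norm_cast)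
  rw [← mpullback_inv_mulInvariantVectorField]
  refine (mdifferentiable_mulInvariantVectorField (-ξ)).mpullback_vectorField
    (contMDiff_inv 𝓘(ℝ, E) ∞) (fun p => ?_) (by norm_cast)
  have h1 := differentialAt_inv_comp (E := E) p
  have h2 := differentialAt_inv_comp (E := E) p⁻¹
  rw [inv_inv] at h2
  exact ContinuousLinearMap.IsInvertible.of_inverse h2 h1

/-- Right-invariant fields bracket with the opposite sign to the Lie algebra, which is defined by
left-invariant fields. -/
theorem mlieBracket_rightInvariantField [CompleteSpace E] (ξ₁ ξ₂ : GroupLieAlgebra 𝓘(ℝ, E) N) :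
    mlieBracket 𝓘(ℝ, E) (rightInvariantField ξ₁) (rightInvariantField ξ₂) =
      rightInvariantField (-⁅ξ₁, ξ₂⁆) := by
  have : LieGroup 𝓘(ℝ, E) (minSmoothness ℝ 3) N := .of_le (n := ∞) (by simp; norm_cast)
  rw [← mpullback_inv_mulInvariantVectorField, ← mpullback_inv_mulInvariantVectorField,
    ← mpullback_inv_mulInvariantVectorField]
  ext p
  rw [← mpullback_mlieBracket (n := ∞) (mdifferentiableAt_mulInvariantVectorField _)
    (mdifferentiableAt_mulInvariantVectorField _) (contMDiff_inv 𝓘(ℝ, E) ∞ p)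
    (by simp; norm_cast), ← mulInvariantVector_mlieBracket, ← GroupLieAlgebra.bracket_def]
  simp only [neg_lie, lie_neg, neg_neg]

end RightInvariant

end MagneticLie

end

theorem mainTheorem2 {E : Type*} [NormedAddCommGroup E] [NormedSpace ℝ E] [FiniteDimensional ℝ E]
    {N : Type*} [TopologicalSpace N] [ChartedSpace E N] [Group N] [LieGroup 𝓘(ℝ, E) ∞ N]
    [ConnectedSpace N]
    (g : MagneticLie.Metric E N) (hg : MagneticLie.IsLeftInvariantMetric g)
    (F : MagneticLie.LorentzForce g) (hF : F.IsLeftInvariant)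
    (ξ₁ ξ₂ : GroupLieAlgebra 𝓘(ℝ, E) N) (f₁ f₂ : N → ℝ)
    (hf₁ : MagneticLie.IsMagneticPotential F (MagneticLie.rightInvariantField ξ₁) f₁)
    (hf₂ : MagneticLie.IsMagneticPotential F (MagneticLie.rightInvariantField ξ₂) f₂) :
    MagneticLie.IsNondegenerate (MagneticLie.twistedForm F) ∧
      (MagneticLie.poissonBracket (MagneticLie.twistedForm F)
          (MagneticLie.momentum g (MagneticLie.rightInvariantField ξ₁) f₁)
          (MagneticLie.momentum g (MagneticLie.rightInvariantField ξ₂) f₂) = 0 ↔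
        ⁅ξ₁, ξ₂⁆ = 0 ∧ F.form 1 ![ξ₁, ξ₂] = 0) := by
  have : CompleteSpace E := FiniteDimensional.complete ℝ E
  have hd₁ := MagneticLie.mdifferentiable_rightInvariantField ξ₁
  have hd₂ := MagneticLie.mdifferentiable_rightInvariantField ξ₂
  have hform : F.form 1 ![ξ₁, ξ₂] = MagneticLie.metricAt g 1 (MagneticLie.forceAt F 1
      (MagneticLie.rightInvariantField ξ₁ 1)) (MagneticLie.rightInvariantField ξ₂ 1) := by
    rw [MagneticLie.rightInvariantField_one, MagneticLie.rightInvariantField_one]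
    rfl
  refine ⟨MagneticLie.isNondegenerate_twistedForm F, fun h => ?_, fun ⟨hbr, hω⟩ => ?_⟩
  · have hval (b : E) := (MagneticLie.poissonBracket_momentum hf₁ hf₂ hd₁ hd₂
      (⟨1, b⟩ : TangentBundle 𝓘(ℝ, E) N)).symm.trans (congr_fun h _)
    -- At the zero vector over the identity only the magnetic term remains.
    have h0 := hval 0
    have hω : F.form 1 ![ξ₁, ξ₂] = 0 := by
      rw [hform]
      exact (sub_zero _).symm.trans ((congrArg _ (map_zero _).symm).trans h0)
    refine ⟨?_, hω⟩
    -- The bracket is orthogonal to every vector, in particular to itself.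
    have hb := hval (VectorField.mlieBracket 𝓘(ℝ, E) (MagneticLie.rightInvariantField ξ₁)
      (MagneticLie.rightInvariantField ξ₂) 1)
    rw [← hform, hω] at hb
    have hz := MagneticLie.eq_zero_of_metricAt_self g 1 _ (by simpa using! hb)
    rw [MagneticLie.mlieBracket_rightInvariantField, MagneticLie.rightInvariantField_one] at hz
    exact neg_eq_zero.1 hz
  · have hzero (p : N) : VectorField.mlieBracket 𝓘(ℝ, E) (MagneticLie.rightInvariantField ξ₁)
        (MagneticLie.rightInvariantField ξ₂) p = 0 := by
      rw [MagneticLie.mlieBracket_rightInvariantField, hbr, neg_zero]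
      exact map_zero (MagneticLie.differentialAt (E := E) (fun q : N => q * p) 1)
    have hconst := MagneticLie.eq_of_hasMFDerivAt_zero
      (fun p => MagneticLie.hasMFDerivAt_form_zero hf₁ hf₂ (hd₁ p) (hd₂ p) (hzero p))
    funext v
    refine (MagneticLie.poissonBracket_momentum hf₁ hf₂ hd₁ hd₂ v).trans ?_
    have h1 := (hconst v.proj 1).trans (hform.symm.trans hω)
    rw [h1, hzero, zero_sub]
    exact neg_eq_zero.2 (DFunLike.congr_fun (map_zero (MagneticLie.metricAt g v.proj)) _)
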